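/- Let $n\ge 1$ and let $\mathbf v=\mathbf v_1\mathbf v_2\cdots\mathbf v_{n-1}$ be a word of length $n-1$ in the two letters $\mathbf x,\mathbf y$. The descent polytope $\mathrm{DP}_{\mathbf v}\subseteq\mathbb R^n$ is the set of points $(x_1,\dots,x_n)\in[0,1]^n$ such that, for $1\le i\le n-1$, $x_i\le x_{i+1}$ if $\mathbf v_i=\mathbf x$ and $x_i\ge x_{i+1}$ if $\mathbf v_i=\mathbf y$. Let $F_{\mathbf v}(t)=\sum_{i=0}^{n} f_i\,t^i$ be its $f$-polynomial, where $f_i$ is the (finite) number of $i$-dimensional nonempty faces of $\mathrm{DP}_{\mathbf v}$, the polytope itself being counted as a face. For $T=\{j_1<j_2<\cdots<j_k\}\subseteq[n-1]=\{1,\dots,n-1\}$ let $\mathbf v^T=\mathbf v_{j_1}\mathbf v_{j_2}\cdots\mathbf v_{j_k}$. For a nonempty word $\mathbf w=\mathbf w_1\cdots\mathbf w_k$ let $\kappa(\mathbf w)=2+|\{i: 1\le i\le k-1,\ \mathbf w_i\ne\mathbf w_{i+1}\}|$, and let $\kappa(\mathbf w)=1$ if $\mathbf w$ is the empty word. Then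 $$F_{\mathbf v}(t)=1+\sum_{T\subseteq[n-1]}\left(\frac{t+1}{t}\right)^{\kappa(\mathbf v^T)}\cdot t^{|T|+1}.$$ -/

import Mathlib

open Polynomial

/-- The two-letter alphabet. -/
inductive XYLetter where
  | x
  | y
deriving DecidableEq

/-- The descent polytope `DP_S ⊆ ℝⁿ` of a set `S ⊆ [n - 1]`, where `n = m + 1`: the points of the
unit cube with `x_i ≥ x_{i+1}` for `i ∈ S` and `x_i ≤ x_{i+1}` for `i ∉ S`. (Indices start
at `0`: `Fin (m + 1)` plays the role of `[n]`, and `Fin m` that of `[n - 1]`.) -/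
def descentPolytope {m : ℕ} (S : Finset (Fin m)) : Set (Fin (m + 1) → ℝ) :=
  {p | (∀ i, 0 ≤ p i ∧ p i ≤ 1) ∧
    ∀ i : Fin m, (i ∈ S → p i.castSucc ≥ p i.succ) ∧ (i ∉ S → p i.castSucc ≤ p i.succ)}

/-- The set encoded by a word: the positions of the letter `y`. -/
def wordSet (v : List XYLetter) : Finset (Fin v.length) :=
  {i | v.get i = XYLetter.y}

/-- The descent polytope `DP_v` of a word `v`; it lives in `ℝⁿ` with `n = v.length + 1`. -/
def wordDescentPolytope (v : List XYLetter) : Set (Fin (v.length + 1) → ℝ) :=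
  descentPolytope (wordSet v)

/-- The subword `v^T = v_{j₁} v_{j₂} ⋯ v_{j_k}` of `v` for `T = {j₁ < j₂ < ⋯ < j_k}`. -/
def subword (v : List XYLetter) (T : Finset (Fin v.length)) : List XYLetter :=
  ((List.finRange v.length).filter (fun i => i ∈ T)).map v.get

/-- The number of positions `i` with `w_i ≠ w_{i+1}`. -/
def letterChanges : List XYLetter → ℕ
  | [] => 0
  | [_] => 0
  | a :: b :: w => (if a ≠ b then 1 else 0) + letterChanges (b :: w)

/-- The statistic `κ`: `1` on the empty word, and `2` plus the number of letter changes on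
nonempty words. -/
def kappa (w : List XYLetter) : ℕ :=
  if w = [] then 1 else 2 + letterChanges w

section Faces

variable {E : Type*} [AddCommGroup E] [Module ℝ E] [TopologicalSpace E]

/-- The nonempty faces of a convex polytope `P`, with `P` itself included (take the zero
functional): the nonempty subsets of `P` on which some linear functional attains its maximum
over `P`. -/
def polytopeFaces (P : Set E) : Set (Set E) :=
  {F | F.Nonempty ∧ IsExposed ℝ P F}

/-- The dimension of a nonempty face, i.e. the dimension of its affine hull. -/
noncomputable def faceDim (F : Set E) : ℕ :=
  Module.finrank ℝ (vectorSpan ℝ F)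

/-- The number `f_i(P)` of `i`-dimensional faces of `P`. -/
noncomputable def fNumber (P : Set E) (i : ℕ) : ℕ :=
  {F ∈ polytopeFaces P | faceDim F = i}.ncard

/-- The `f`-polynomial `∑ f_i(P) tⁱ` of a polytope `P` in a finite-dimensional space, where
`i` runs from `0` to the dimension of the space (`f_i(P) = 0` for larger `i`). -/
noncomputable def fPolynomial (P : Set E) : ℤ[X] :=
  ∑ i ∈ Finset.range (Module.finrank ℝ E + 1), (fNumber P i : ℤ[X]) * X ^ i

end Faces

/-!
The relative interiors of the faces of a polytope partition it, so a face is the same as the set of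
inequalities that are tight at a point (`tightFace_mem_polytopeFaces`, `exists_eq_tightFace`), and
its direction is cut out by the corresponding linear equations (`mem_vectorSpan_tightFace`). For a
descent polytope the tight inequalities at `p` are recorded by a pattern: the set `T` of positions
where consecutive coordinates differ, together with the information which coordinates are `0`, are
`1`, or lie strictly in between ("free"). Since the comparisons required at the positions in `T`
are strict, the labels on both sides of such a position are restricted, and every pattern obeying
these restrictions is realized by a point (`exists_point_of_isPattern`). Hence faces correspond to
patterns (`bijOn_patternFace`), and the dimension of a face is the number of maximal blocks of
equal free coordinates (`faceDim_patternFace`).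

For fixed `T`, a pattern is a labeling of the `|T| + 1` blocks, and the restrictions depend only on
the word `v^T` between the blocks (`sum_pattern_eq_blockSum`). A block between two equal letters has
to be free and contributes `t`; a block between two different letters, and a block at either end,
may also take exactly one of the values `0` and `1`, and contributes `t + 1`. This gives the term
`((t + 1) / t) ^ κ * t ^ (|T| + 1)` (`tailSum_mul_pow`, `algebraMap_sum_blockSum`), except that for
`T = ∅` the single block may take both values: this is the additional `1` in the formula.
-/

/-! ### Parametrized families of faces -/

open Finset in
/-- If the faces are parametrized bijectively by a finite set, then the `f`-polynomial is the sum of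
`X ^ dim` over the parameters. -/
theorem fPolynomial_eq_sum_of_bijOn {E : Type*} [AddCommGroup E] [Module ℝ E] [TopologicalSpace E]
    [FiniteDimensional ℝ E] {P : Set E} {κ : Type*} (s : Finset κ) (Φ : κ → Set E) (w : κ → ℕ)
    (hΦ : Set.BijOn Φ s (polytopeFaces P)) (hw : ∀ k ∈ s, faceDim (Φ k) = w k) :
    fPolynomial P = ∑ k ∈ s, (X : ℤ[X]) ^ w k := by
  have hcard (i : ℕ) : fNumber P i = #{k ∈ s | w k = i} := by
    have himage : {F ∈ polytopeFaces P | faceDim F = i} = Φ '' ({k ∈ s | w k = i} : Finset κ) := by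
      ext F
      simp only [Set.mem_ofPred_eq, Set.mem_image, Finset.mem_coe, Finset.mem_filter]
      constructor
      · rintro ⟨hF, hdim⟩
        obtain ⟨k, hk, rfl⟩ := hΦ.surjOn hF
        exact ⟨k, ⟨hk, (hw k hk).symm.trans hdim⟩, rfl⟩
      · rintro ⟨k, ⟨hk, hki⟩, rfl⟩
        exact ⟨hΦ.mapsTo hk, (hw k hk).trans hki⟩
    rw [fNumber, himage, Set.InjOn.ncard_image, Set.ncard_coe_finset]
    exact hΦ.injOn.mono fun k hk => (Finset.mem_filter.1 hk).1
  have hmaps : ∀ k ∈ s, w k ∈ range (Module.finrank ℝ E + 1) := fun k hk => by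
    rw [Finset.mem_range, ← hw k hk]
    exact Nat.lt_succ_of_le (Submodule.finrank_le _)
  rw [fPolynomial, ← Finset.sum_fiberwise_of_maps_to hmaps]
  refine Finset.sum_congr rfl fun i _ => ?_
  rw [hcard, Finset.sum_congr rfl fun k hk => by rw [(Finset.mem_filter.1 hk).2]]
  simp

/-! ### Faces of a polyhedron given by finitely many inequalities -/

section Polyhedron

variable {E : Type*} [AddCommGroup E] [Module ℝ E] [TopologicalSpace E] {ι : Type*}

/-- The polyhedron of the points satisfying `a j p ≤ b j` for all `j`. -/
def polyhedron (a : ι → E →L[ℝ] ℝ) (b : ι → ℝ) : Set E :=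
  {p | ∀ j, a j p ≤ b j}

/-- The points of the polyhedron that satisfy with equality every inequality that `p` satisfies
with equality: the smallest face containing `p`, when `p` lies in the polyhedron. -/
def tightFace (a : ι → E →L[ℝ] ℝ) (b : ι → ℝ) (p : E) : Set E :=
  {q ∈ polyhedron a b | ∀ j, a j p = b j → a j q = b j}

variable {a : ι → E →L[ℝ] ℝ} {b : ι → ℝ} {p : E}

theorem mem_tightFace_self (hp : p ∈ polyhedron a b) : p ∈ tightFace a b p :=
  ⟨hp, fun _ h => h⟩

/-- Directions orthogonal to the tight normals are feasible, since finitely many slack inequalities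
survive a small displacement. -/
theorem exists_pos_add_smul_mem_polyhedron [Finite ι] (hp : p ∈ polyhedron a b) {d : E}
    (hd : ∀ j, a j p = b j → a j d = 0) : ∃ ε : ℝ, 0 < ε ∧ p + ε • d ∈ polyhedron a b := by
  have hev : ∀ᶠ ε : ℝ in nhdsWithin 0 (Set.Ioi 0), ∀ j, a j p + ε * a j d ≤ b j := by
    refine Filter.eventually_all.2 fun j => ?_
    rcases (hp j).eq_or_lt with h | h
    · simp [hd j h, h]
    · have hcont : Filter.Tendsto (fun ε : ℝ => a j p + ε * a j d) (nhds 0)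
          (nhds (a j p + 0 * a j d)) := by
        apply Continuous.tendsto (f := fun ε : ℝ => a j p + ε * a j d)
        fun_prop
      rw [zero_mul, add_zero] at hcont
      exact ((hcont.eventually_lt_const h).mono fun _ h => h.le).filter_mono nhdsWithin_le_nhds
  obtain ⟨ε, hε, hpos⟩ := (hev.and self_mem_nhdsWithin).exists
  exact ⟨ε, hpos, fun j => by simpa using hε j⟩

/-- The sum of the functionals that are tight at `p` exposes `tightFace a b p`. -/
theorem tightFace_mem_polytopeFaces [Finite ι] [IsTopologicalAddGroup E] [ContinuousSMul ℝ E]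
    (hp : p ∈ polyhedron a b) : tightFace a b p ∈ polytopeFaces (polyhedron a b) := by
  classical
  have := Fintype.ofFinite ι
  refine ⟨⟨p, mem_tightFace_self hp⟩, fun _ => ?_⟩
  let s : Finset ι := {j | a j p = b j}
  have hs {j : ι} : j ∈ s ↔ a j p = b j := by simp [s]
  have hle {q : E} (hq : q ∈ polyhedron a b) : (∑ j ∈ s, a j) q ≤ ∑ j ∈ s, b j := by
    rw [sum_apply]
    exact Finset.sum_le_sum fun j _ => hq j
  refine ⟨∑ j ∈ s, a j, Set.ext fun q => and_congr_right fun hq => ⟨fun h y hy => ?_, fun h => ?_⟩⟩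
  · refine (hle hy).trans_eq ?_
    rw [sum_apply]
    exact Finset.sum_congr rfl fun j hj => (h j (hs.1 hj)).symm
  · have hqp : (∑ j ∈ s, a j) q = ∑ j ∈ s, b j := by
      refine (hle hq).antisymm (le_trans (le_of_eq ?_) (h p hp))
      rw [sum_apply]
      exact Finset.sum_congr rfl fun j hj => (hs.1 hj).symm
    rw [sum_apply, Finset.sum_eq_sum_iff_of_le fun j _ => hq j] at hqp
    exact fun j hj => hqp j (hs.2 hj)

/-- Every face is `tightFace a b p`, where `p` is any point of the face with the fewest tight
inequalities, that is, a point of its relative interior. -/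
theorem exists_eq_tightFace [Finite ι] {F : Set E} (hF : F ∈ polytopeFaces (polyhedron a b)) :
    ∃ p ∈ polyhedron a b, F = tightFace a b p := by
  obtain ⟨hne, hexp⟩ := hF
  obtain ⟨l, rfl⟩ := hexp hne
  obtain ⟨p, hpF, hmin⟩ := WellFounded.has_min
    (measure fun p : E => {j | a j p = b j}.ncard).wf _ hne
  refine ⟨p, hpF.1, Set.ext fun q => ⟨fun hq => ⟨hq.1, fun j hj => ?_⟩, fun hq => ⟨hq.1, ?_⟩⟩⟩
  · -- The midpoint of `p` and `q` lies in the face and is tight only where both `p` and `q` are.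
    let r : E := (1 / 2 : ℝ) • p + (1 / 2 : ℝ) • q
    have hr (f : E →L[ℝ] ℝ) : f r = (f p + f q) / 2 := by
      simp [r]; ring
    have hrF : r ∈ {x ∈ polyhedron a b | ∀ y ∈ polyhedron a b, l y ≤ l x} := by
      refine ⟨fun j => ?_, fun y hy => ?_⟩
      · rw [hr]; linarith [hpF.1 j, hq.1 j]
      · rw [hr]; linarith [hpF.2 y hy, hq.2 y hy]
    have hsub : {j | a j r = b j} ⊆ {j | a j p = b j} := fun j hj => by
      have hj' : a j r = b j := hj
      rw [hr] at hj'
      change a j p = b j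
      linarith [hpF.1 j, hq.1 j]
    have heq := Set.eq_of_subset_of_ncard_le hsub (not_lt.1 (hmin r hrF)) (Set.toFinite _)
    have hjr : a j r = b j := heq.ge hj
    rw [hr] at hjr
    linarith
  · -- The segment from `q` to `p` can be prolonged beyond `p` inside the polyhedron.
    obtain ⟨ε, hε, hmem⟩ := exists_pos_add_smul_mem_polyhedron hpF.1 (d := p - q)
      fun j hj => by simp [hj, hq.2 j hj]
    have hl := hpF.2 _ hmem
    simp only [map_add, map_smul, map_sub, smul_eq_mul] at hl
    have hlpq : l p ≤ l q := by nlinarith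
    exact fun y hy => (hpF.2 y hy).trans hlpq

/-- The direction of the face is cut out by the inequalities that are tight at `p`. -/
theorem mem_vectorSpan_tightFace [Finite ι] (hp : p ∈ polyhedron a b) {d : E} :
    d ∈ vectorSpan ℝ (tightFace a b p) ↔ ∀ j, a j p = b j → a j d = 0 := by
  constructor
  · intro hd j hj
    have hle : vectorSpan ℝ (tightFace a b p) ≤ LinearMap.ker (a j : E →ₗ[ℝ] ℝ) := by
      refine Submodule.span_le.2 ?_
      rintro _ ⟨q, hq, r, hr, rfl⟩
      simp [hq.2 j hj, hr.2 j hj]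
    exact hle hd
  · intro hd
    obtain ⟨ε, hε, hmem⟩ := exists_pos_add_smul_mem_polyhedron hp hd
    have hface : p + ε • d ∈ tightFace a b p := ⟨hmem, fun j hj => by simp [hj, hd j hj]⟩
    have := vsub_mem_vectorSpan ℝ hface (mem_tightFace_self hp)
    rw [vsub_eq_sub, add_sub_cancel_left] at this
    simpa [smul_smul, hε.ne'] using Submodule.smul_mem _ ε⁻¹ this

end Polyhedron

/-! ### Sign patterns of points of a descent polytope -/

/-- The position of a coordinate in `[0, 1]`: at `0`, at `1`, or strictly in between. -/
inductive CoordLabel where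
  | zero
  | free
  | one
deriving DecidableEq

open CoordLabel XYLetter

instance : Fintype CoordLabel := ⟨{zero, free, one}, fun l => by cases l <;> simp⟩

theorem sum_coordLabel {M : Type*} [AddCommMonoid M] (f : CoordLabel → M) :
    ∑ l, f l = f zero + f free + f one := by
  change ∑ l ∈ ({zero, free, one} : Finset CoordLabel), f l = _
  simp [add_assoc]

/-- The label of a real number, with every number other than `0` and `1` counted as free. -/
noncomputable def coordLabel (r : ℝ) : CoordLabel :=
  if r = 0 then zero else if r = 1 then one else free

theorem coordLabel_eq_zero {r : ℝ} : coordLabel r = zero ↔ r = 0 := by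
  unfold coordLabel; split_ifs <;> simp_all

theorem coordLabel_eq_one {r : ℝ} : coordLabel r = one ↔ r = 1 := by
  unfold coordLabel; split_ifs <;> simp_all

/-- Whether labels `k`, `l` may stand on the two sides of a strict step: `<` for the letter
`x`, and `>` for the letter `y`. -/
def StepAllowed : XYLetter → CoordLabel → CoordLabel → Prop
  | x, k, l => k ≠ one ∧ l ≠ zero
  | y, k, l => k ≠ zero ∧ l ≠ one

instance (a : XYLetter) (k l : CoordLabel) : Decidable (StepAllowed a k l) := by
  cases a <;> unfold StepAllowed <;> infer_instance

variable {m : ℕ}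

/-- The sign patterns `(T, c)` of points of the descent polytope of `u`: `T` is the set of positions
`i` where the coordinates `i` and `i + 1` differ, and `c` lists the labels of the coordinates. -/
def IsPattern (u : Fin m → XYLetter) (T : Finset (Fin m)) (c : Fin (m + 1) → CoordLabel) : Prop :=
  ∀ i, (i ∉ T → c i.castSucc = c i.succ) ∧ (i ∈ T → StepAllowed (u i) (c i.castSucc) (c i.succ))

instance (u : Fin m → XYLetter) (T : Finset (Fin m)) (c : Fin (m + 1) → CoordLabel) :
    Decidable (IsPattern u T c) := by
  unfold IsPattern; infer_instance

/-- The number of maximal blocks of equal free coordinates, each counted at its first position. -/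
def freeBlocks (T : Finset (Fin m)) (c : Fin (m + 1) → CoordLabel) : ℕ :=
  (if c 0 = free then 1 else 0) + ∑ i, if i ∈ T ∧ c i.succ = free then 1 else 0

/-- The descent polytope of a word `u`, given as a function. -/
abbrev letterPolytope (u : Fin m → XYLetter) : Set (Fin (m + 1) → ℝ) :=
  descentPolytope {i | u i = y}

theorem mem_letterPolytope {u : Fin m → XYLetter} {p : Fin (m + 1) → ℝ} :
    p ∈ letterPolytope u ↔ (∀ i, 0 ≤ p i ∧ p i ≤ 1) ∧
      ∀ i, (u i = x → p i.castSucc ≤ p i.succ) ∧ (u i = y → p i.succ ≤ p i.castSucc) := by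
  refine and_congr_right fun _ => forall_congr' fun i => ?_
  cases h : u i <;> simp [h]

/-- The set of positions where consecutive coordinates differ. -/
noncomputable def cutSet (p : Fin (m + 1) → ℝ) : Finset (Fin m) :=
  {i | p i.castSucc ≠ p i.succ}

theorem notMem_cutSet {p : Fin (m + 1) → ℝ} {i : Fin m} :
    i ∉ cutSet p ↔ p i.castSucc = p i.succ := by
  simp [cutSet]

theorem isPattern_of_mem {u : Fin m → XYLetter} {p : Fin (m + 1) → ℝ} (hp : p ∈ letterPolytope u) :
    IsPattern u (cutSet p) (coordLabel ∘ p) := by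
  rw [mem_letterPolytope] at hp
  obtain ⟨hbox, hstep⟩ := hp
  refine fun i => ⟨fun hi => by simp [notMem_cutSet.1 hi], fun hi => ?_⟩
  have hne : p i.castSucc ≠ p i.succ := by simpa [cutSet] using hi
  have h1 := hbox i.castSucc
  have h2 := hbox i.succ
  cases hu : u i
  · have hlt := ((hstep i).1 hu).lt_of_ne hne
    simp only [StepAllowed, Function.comp, ne_eq, coordLabel_eq_zero, coordLabel_eq_one]
    constructor <;> intro h <;> linarith
  · have hlt := ((hstep i).2 hu).lt_of_ne hne.symm
    simp only [StepAllowed, Function.comp, ne_eq, coordLabel_eq_zero, coordLabel_eq_one]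
    constructor <;> intro h <;> linarith

/-- The height of a lattice path that goes up at the letters `x` in `T`, goes down at the letters
`y` in `T`, and stays level elsewhere. -/
def pathHeight (u : Fin m → XYLetter) (T : Finset (Fin m)) : Fin (m + 1) → ℝ :=
  Fin.induction 0 fun i h => if i ∈ T then (if u i = x then h + 1 else h - 1) else h

theorem pathHeight_succ (u : Fin m → XYLetter) (T : Finset (Fin m)) (i : Fin m) :
    pathHeight u T i.succ = if i ∈ T then
      (if u i = x then pathHeight u T i.castSucc + 1 else pathHeight u T i.castSucc - 1)
      else pathHeight u T i.castSucc :=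
  Fin.induction_succ ..

/-- The number with a prescribed label and, if the label is free, a value in `(0, 1)` that
increases with the height `h`. -/
noncomputable def labelValue (l : CoordLabel) (h : ℝ) : ℝ :=
  match l with
  | zero => 0
  | free => Real.sigmoid h
  | one => 1

theorem labelValue_mem (l : CoordLabel) (h : ℝ) : 0 ≤ labelValue l h ∧ labelValue l h ≤ 1 := by
  cases l <;> simp [labelValue, Real.sigmoid_nonneg, Real.sigmoid_le_one]

theorem coordLabel_labelValue (l : CoordLabel) (h : ℝ) : coordLabel (labelValue l h) = l := by
  cases l <;> simp [labelValue, coordLabel, (Real.sigmoid_pos h).ne', (Real.sigmoid_lt_one h).ne]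

theorem labelValue_lt {k l : CoordLabel} (hkl : StepAllowed x k l) {g h : ℝ} (hgh : g < h) :
    labelValue k g < labelValue l h := by
  cases k <;> cases l <;>
    simp_all [StepAllowed, labelValue, Real.sigmoid_pos, Real.sigmoid_lt_one, Real.sigmoid_lt]

theorem StepAllowed.symm {k l : CoordLabel} (h : StepAllowed y k l) : StepAllowed x l k :=
  ⟨h.2, h.1⟩

/-- Every pattern is realized by a point: free coordinates follow a path that is strictly monotone
at the cuts. -/
theorem exists_point_of_isPattern {u : Fin m → XYLetter} {T : Finset (Fin m)}
    {c : Fin (m + 1) → CoordLabel} (h : IsPattern u T c) :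
    ∃ p ∈ letterPolytope u, cutSet p = T ∧ coordLabel ∘ p = c := by
  let p : Fin (m + 1) → ℝ := fun i => labelValue (c i) (pathHeight u T i)
  have heq : ∀ i ∉ T, p i.castSucc = p i.succ := fun i hi => by
    simp [p, pathHeight_succ, hi, (h i).1 hi]
  have hlt : ∀ i ∈ T, u i = x → p i.castSucc < p i.succ := fun i hi hu => by
    refine labelValue_lt (hu ▸ (h i).2 hi) ?_
    simp [pathHeight_succ, hi, hu]
  have hgt : ∀ i ∈ T, u i = y → p i.succ < p i.castSucc := fun i hi hu => by
    refine labelValue_lt (hu ▸ (h i).2 hi).symm ?_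
    simp [pathHeight_succ, hi, hu]
  refine ⟨p, mem_letterPolytope.2 ⟨fun i => labelValue_mem _ _, fun i => ?_⟩, ?_,
    funext fun i => coordLabel_labelValue _ _⟩
  · by_cases hi : i ∈ T
    · exact ⟨fun hu => (hlt i hi hu).le, fun hu => (hgt i hi hu).le⟩
    · simp [heq i hi]
  · ext i
    rw [← not_iff_not, notMem_cutSet]
    refine ⟨fun hp hi => ?_, heq i⟩
    cases hu : u i
    · exact (hlt i hi hu).ne hp
    · exact (hgt i hi hu).ne' hp

/-! ### Faces of a descent polytope and their dimensions -/

/-- The normals of the inequalities `0 ≤ p i`, `p i ≤ 1` and of the comparisons of consecutive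
coordinates. -/
noncomputable def descentNormal (u : Fin m → XYLetter) :
    (Fin (m + 1) ⊕ Fin (m + 1)) ⊕ Fin m → (Fin (m + 1) → ℝ) →L[ℝ] ℝ :=
  let e (i : Fin (m + 1)) : (Fin (m + 1) → ℝ) →L[ℝ] ℝ := ContinuousLinearMap.proj i
  Sum.elim (Sum.elim (fun i => -e i) e)
    fun i => if u i = x then e i.castSucc - e i.succ else e i.succ - e i.castSucc

/-- The right-hand sides of the inequalities with normals `descentNormal u`. -/
def descentBound : (Fin (m + 1) ⊕ Fin (m + 1)) ⊕ Fin m → ℝ :=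
  Sum.elim (Sum.elim 0 1) 0

theorem letterPolytope_eq_polyhedron (u : Fin m → XYLetter) :
    letterPolytope u = polyhedron (descentNormal u) descentBound := by
  ext p
  rw [mem_letterPolytope]
  simp only [polyhedron, Set.mem_ofPred_eq, Sum.forall, descentNormal, descentBound, Sum.elim_inl,
    Sum.elim_inr, forall_and]
  refine and_congr (by simp) ?_
  rw [← forall_and]
  refine forall_congr' fun i => ?_
  cases h : u i <;> simp

theorem descentNormal_inr_eq_zero {u : Fin m → XYLetter} {p : Fin (m + 1) → ℝ} {i : Fin m} :
    descentNormal u (Sum.inr i) p = 0 ↔ p i.castSucc = p i.succ := by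
  cases h : u i
  · simp [descentNormal, h, sub_eq_zero]
  · simp [descentNormal, h, sub_eq_zero, eq_comm]

/-- The points of the descent polytope of `u` that satisfy the equations prescribed by `(T, c)`. -/
def patternFace (u : Fin m → XYLetter) (k : Finset (Fin m) × (Fin (m + 1) → CoordLabel)) :
    Set (Fin (m + 1) → ℝ) :=
  {q ∈ letterPolytope u | (∀ i, k.2 i = zero → q i = 0) ∧ (∀ i, k.2 i = one → q i = 1) ∧
    ∀ i ∉ k.1, q i.castSucc = q i.succ}

theorem patternFace_eq_tightFace (u : Fin m → XYLetter) (p : Fin (m + 1) → ℝ) :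
    patternFace u (cutSet p, coordLabel ∘ p) = tightFace (descentNormal u) descentBound p := by
  ext q
  rw [patternFace, tightFace, ← letterPolytope_eq_polyhedron]
  refine and_congr_right fun _ => ?_
  simp only [Sum.forall, notMem_cutSet, Function.comp, coordLabel_eq_zero, coordLabel_eq_one,
    descentBound, Sum.elim_inr, Pi.zero_apply, descentNormal_inr_eq_zero]
  simp [descentNormal, and_assoc]

theorem injOn_patternFace (u : Fin m → XYLetter) :
    Set.InjOn (patternFace u) {k | IsPattern u k.1 k.2} := by
  -- A point realizing one pattern satisfies the equations of the other, and conversely.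
  have key {p q : Fin (m + 1) → ℝ} (hq : q ∈ letterPolytope u)
      (h : patternFace u (cutSet p, coordLabel ∘ p) = patternFace u (cutSet q, coordLabel ∘ q)) :
      (∀ i, p i = 0 → q i = 0) ∧ (∀ i, p i = 1 → q i = 1) ∧
        ∀ i : Fin m, p i.castSucc = p i.succ → q i.castSucc = q i.succ := by
    have hmem : q ∈ patternFace u (cutSet q, coordLabel ∘ q) :=
      ⟨hq, fun _ => coordLabel_eq_zero.1, fun _ => coordLabel_eq_one.1, fun _ => notMem_cutSet.1⟩
    rw [← h] at hmem
    simpa [coordLabel_eq_zero, coordLabel_eq_one, notMem_cutSet] using hmem.2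
  rintro ⟨T, c⟩ hT ⟨T', c'⟩ hT' h
  obtain ⟨p, hp, rfl, rfl⟩ := exists_point_of_isPattern hT
  obtain ⟨q, hq, rfl, rfl⟩ := exists_point_of_isPattern hT'
  obtain ⟨h0, h1, h2⟩ := key hq h
  obtain ⟨h0', h1', h2'⟩ := key hp h.symm
  refine Prod.ext (Finset.ext fun i => ?_) (funext fun i => ?_)
  · rw [← not_iff_not, notMem_cutSet, notMem_cutSet]
    exact ⟨h2 i, h2' i⟩
  · have e0 : p i = 0 ↔ q i = 0 := ⟨h0 i, h0' i⟩
    have e1 : p i = 1 ↔ q i = 1 := ⟨h1 i, h1' i⟩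
    simp only [Function.comp, coordLabel, e0, e1]

theorem bijOn_patternFace (u : Fin m → XYLetter) :
    Set.BijOn (patternFace u) {k | IsPattern u k.1 k.2} (polytopeFaces (letterPolytope u)) := by
  refine ⟨?_, injOn_patternFace u, ?_⟩
  · rintro ⟨T, c⟩ hT
    obtain ⟨p, hp, rfl, rfl⟩ := exists_point_of_isPattern hT
    rw [letterPolytope_eq_polyhedron] at hp ⊢
    rw [patternFace_eq_tightFace]
    exact tightFace_mem_polytopeFaces hp
  · intro F hF
    rw [letterPolytope_eq_polyhedron] at hF
    obtain ⟨p, hp, rfl⟩ := exists_eq_tightFace hF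
    rw [← letterPolytope_eq_polyhedron] at hp
    exact ⟨_, isPattern_of_mem hp, patternFace_eq_tightFace u p⟩

/-- The first positions of the blocks of free coordinates. -/
def blockHeads (T : Finset (Fin m)) (c : Fin (m + 1) → CoordLabel) : Finset (Fin (m + 1)) :=
  {i | c i = free ∧ ∀ j : Fin m, i = j.succ → j ∈ T}

theorem card_blockHeads (T : Finset (Fin m)) (c : Fin (m + 1) → CoordLabel) :
    (blockHeads T c).card = freeBlocks T c := by
  rw [blockHeads, Finset.card_filter, Fin.sum_univ_succ, freeBlocks]
  congr 1
  · simp [Fin.ext_iff]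
  · simp [and_comm]

/-- A vector that vanishes at the non-free coordinates and is constant along blocks is determined by
its values at the first positions of the free blocks, which are arbitrary. -/
theorem faceDim_patternFace {u : Fin m → XYLetter}
    {k : Finset (Fin m) × (Fin (m + 1) → CoordLabel)} (h : IsPattern u k.1 k.2) :
    faceDim (patternFace u k) = freeBlocks k.1 k.2 := by
  obtain ⟨T, c⟩ := k
  have hV {d : Fin (m + 1) → ℝ} : d ∈ vectorSpan ℝ (patternFace u (T, c)) ↔
      (∀ i, c i ≠ free → d i = 0) ∧ ∀ i ∉ T, d i.castSucc = d i.succ := by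
    obtain ⟨p, hp, rfl, rfl⟩ := exists_point_of_isPattern h
    rw [letterPolytope_eq_polyhedron] at hp
    rw [patternFace_eq_tightFace, mem_vectorSpan_tightFace hp]
    have hfree (i) : coordLabel (p i) ≠ free ↔ p i = 0 ∨ p i = 1 := by
      unfold coordLabel; split_ifs <;> simp_all
    simp only [Sum.forall, notMem_cutSet, Function.comp, hfree,
      descentBound, Sum.elim_inr, Pi.zero_apply, descentNormal_inr_eq_zero]
    simp [descentNormal, or_imp, forall_and]
  let f : vectorSpan ℝ (patternFace u (T, c)) →ₗ[ℝ] (blockHeads T c → ℝ) :=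
    (LinearMap.funLeft ℝ ℝ Subtype.val).comp (Submodule.subtype _)
  have hf : Function.Bijective f := by
    constructor
    · rw [← LinearMap.ker_eq_bot, LinearMap.ker_eq_bot']
      rintro ⟨d, hd⟩ hfd
      rw [hV] at hd
      have hhead : ∀ i ∈ blockHeads T c, d i = 0 := fun i hi => congrFun hfd ⟨i, hi⟩
      refine Subtype.ext (funext fun i => ?_)
      by_cases hi : c i = free
      swap
      · exact hd.1 i hi
      induction i using Fin.induction with
      | zero => exact hhead 0 (by simp [blockHeads, hi, Fin.ext_iff])
      | succ i ih =>
        by_cases hT : i ∈ T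
        · exact hhead _ (by simp [blockHeads, hi, hT])
        · exact (hd.2 i hT).symm.trans (ih (((h i).1 hT).trans hi))
    · intro g
      let g' : Fin (m + 1) → ℝ := fun i => if hi : i ∈ blockHeads T c then g ⟨i, hi⟩ else 0
      let d : Fin (m + 1) → ℝ := Fin.induction (g' 0) fun i r => if i ∈ T then g' i.succ else r
      have d_zero : d 0 = g' 0 := rfl
      have d_succ (i : Fin m) : d i.succ = if i ∈ T then g' i.succ else d i.castSucc :=
        Fin.induction_succ ..
      have g'_of_ne {i} (hi : c i ≠ free) : g' i = 0 := dif_neg (by simp [blockHeads, hi])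
      refine ⟨⟨d, hV.2 ⟨fun i hi => ?_, fun i hi => by simp [d_succ, hi]⟩⟩, funext ?_⟩
      · induction i using Fin.induction with
        | zero => exact g'_of_ne hi
        | succ i ih =>
          rw [d_succ]
          split_ifs with hT
          · exact g'_of_ne hi
          · exact ih (((h i).1 hT).trans_ne hi)
      · rintro ⟨i, hi⟩
        have hg : g' i = g ⟨i, hi⟩ := dif_pos hi
        change d i = _
        rw [← hg]
        cases i using Fin.cases with
        | zero => rfl
        | succ i =>
          have hT : i ∈ T := (Finset.mem_filter.1 hi).2.2 i rfl
          simp [d_succ, hT]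
  rw [faceDim, (LinearEquiv.ofBijective f hf).finrank_eq, Module.finrank_fintype_fun_eq_card,
    Fintype.card_coe, card_blockHeads]

theorem fPolynomial_letterPolytope (u : Fin m → XYLetter) :
    fPolynomial (letterPolytope u) =
      ∑ T, ∑ c, if IsPattern u T c then (X : ℤ[X]) ^ freeBlocks T c else 0 := by
  rw [← Fintype.sum_prod_type', ← Finset.sum_filter]
  refine fPolynomial_eq_sum_of_bijOn _ (patternFace u) (fun k => freeBlocks k.1 k.2) ?_ ?_
  · simpa using bijOn_patternFace u
  · exact fun k hk => faceDim_patternFace (Finset.mem_filter.1 hk).2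

/-! ### Weighted count of the patterns with a given cut set -/

/-- The weight of the labelings of the blocks cut out by the word `w`, with first label `l`: a
labeling with `d` free blocks has weight `X ^ d`. -/
noncomputable def blockSum : List XYLetter → CoordLabel → ℤ[X]
  | [], l => if l = free then X else 1
  | a :: w, l => (if l = free then X else 1) * ∑ k, if StepAllowed a l k then blockSum w k else 0

theorem subword_cons (a : XYLetter) (v : List XYLetter) (T : Finset (Fin (a :: v).length)) :
    subword (a :: v) T = (if (0 : Fin (v.length + 1)) ∈ T then [a] else []) ++
      subword v {i | i.succ ∈ T} := by
  simp only [subword, List.length_cons, List.finRange_succ, List.filter_cons, List.filter_map]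
  split_ifs <;> simp_all [Function.comp_def]

theorem isPattern_cons {a : XYLetter} {v : List XYLetter} {T : Finset (Fin (v.length + 1))}
    {l : CoordLabel} {c : Fin (v.length + 1) → CoordLabel} :
    IsPattern (a :: v).get T (Fin.cons l c : Fin (v.length + 2) → CoordLabel) ↔
      ((0 ∉ T → l = c 0) ∧ (0 ∈ T → StepAllowed a l (c 0))) ∧
        IsPattern v.get {i | i.succ ∈ T} c := by
  unfold IsPattern
  refine (Fin.forall_fin_succ (n := v.length)).trans ?_
  simp

/-- The patterns with cut set `T` are the labelings of the blocks cut out by `v^T`: positions outside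
`T` only prolong a block, so they neither restrict the labels nor change the weight. -/
theorem sum_pattern_eq_blockSum (v : List XYLetter) (T : Finset (Fin v.length)) (l : CoordLabel) :
    (∑ c, if IsPattern v.get T c ∧ c 0 = l then (X : ℤ[X]) ^ freeBlocks T c else 0) =
      blockSum (subword v T) l := by
  induction v generalizing l with
  | nil =>
    have hpat (c : Fin 1 → CoordLabel) : IsPattern [].get T c := fun i => i.elim0
    change ∑ c : Fin 1 → CoordLabel, _ = _
    rw [← (Equiv.funUnique (Fin 1) CoordLabel).symm.sum_comp]
    cases l <;> simp [hpat, freeBlocks, subword, blockSum]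
  | cons a v ih =>
    let T' : Finset (Fin v.length) := {i | Fin.succ i ∈ T}
    have hblocks (k : CoordLabel) (c : Fin (v.length + 1) → CoordLabel) :
        freeBlocks T (Fin.cons k c : Fin (v.length + 2) → CoordLabel) =
          (if k = free then 1 else 0) + ((if (0 : Fin (v.length + 1)) ∈ T ∧ c 0 = free then 1 else 0)
            + ∑ i, if i ∈ T' ∧ c i.succ = free then 1 else 0) := by
      unfold freeBlocks
      refine congrArg₂ _ rfl ((Fin.sum_univ_succ (n := v.length) _).trans ?_)
      simp [T']
    have hsplit : (∑ c, if IsPattern (a :: v).get T c ∧ c 0 = l then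
          (X : ℤ[X]) ^ freeBlocks T c else 0) =
        ∑ c, if IsPattern (a :: v).get T (Fin.cons l c : Fin (v.length + 2) → CoordLabel) then
          (X : ℤ[X]) ^ freeBlocks T (Fin.cons l c : Fin (v.length + 2) → CoordLabel) else 0 := by
      change ∑ c : Fin (v.length + 2) → CoordLabel, _ = _
      rw [← (Fin.consEquiv fun _ => CoordLabel).sum_comp, Fintype.sum_prod_type_right]
      refine Finset.sum_congr rfl fun c _ => ?_
      rw [Finset.sum_eq_single l (fun k _ hk => by simp [hk]) (by simp)]
      simp [Fin.consEquiv]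
    rw [hsplit, subword_cons]
    simp only [isPattern_cons, hblocks]
    -- If `0 ∈ T`, the first coordinate is a block of its own; otherwise it belongs to the first
    -- block of the remaining coordinates.
    by_cases h0 : (0 : Fin (v.length + 1)) ∈ T
    · simp only [h0, not_true_eq_false, false_imp_iff, true_imp_iff, true_and, if_true,
        List.cons_append, List.nil_append, blockSum]
      rw [Finset.mul_sum]
      have hterm (k : CoordLabel) : ((if l = free then X else 1) *
            if StepAllowed a l k then blockSum (subword v T') k else 0) =
          ∑ c : Fin (v.length + 1) → CoordLabel, if c 0 = k then
            (if StepAllowed a l (c 0) ∧ IsPattern v.get T' c then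
              (if l = free then X else 1) * X ^ freeBlocks T' c else 0) else 0 := by
        rw [← ih]
        by_cases hk : StepAllowed a l k
        · rw [if_pos hk, Finset.mul_sum]
          refine Finset.sum_congr rfl fun c _ => ?_
          by_cases hc : c 0 = k
          · subst hc; simp [hk]
          · simp [hc]
        · rw [if_neg hk, mul_zero]
          refine (Finset.sum_eq_zero fun c _ => ?_).symm
          by_cases hc : c 0 = k
          · subst hc; simp [hk]
          · simp [hc]
      rw [Finset.sum_congr rfl fun k _ => hterm k, Finset.sum_comm]
      refine Finset.sum_congr rfl fun c _ => ?_
      rw [Finset.sum_ite_eq, if_pos (Finset.mem_univ _), freeBlocks]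
      split_ifs <;> simp_all [pow_add]
    · simp only [h0, not_false_eq_true, false_imp_iff, true_imp_iff, and_true, if_false,
        List.nil_append, ← ih, false_and, zero_add]
      refine Finset.sum_congr rfl fun c _ => ?_
      by_cases hc : c 0 = l
      · subst hc; simp [freeBlocks, T']
      · simp [hc, Ne.symm hc]

theorem sum_blockSum_nil : ∑ l, blockSum [] l = X + 2 := by
  simp [sum_coordLabel, blockSum]; ring

/-- The weighted count of the labelings of all blocks but the first of those cut out by `a :: w`,
where the first block carries a label that may precede a step with the letter `a`. All such first
labels allow the same continuations, so the label `free` stands for any of them. -/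
noncomputable def tailSum (a : XYLetter) (w : List XYLetter) : ℤ[X] :=
  ∑ k, if StepAllowed a free k then blockSum w k else 0

theorem blockSum_cons (a : XYLetter) (w : List XYLetter) (l : CoordLabel) :
    blockSum (a :: w) l =
      if StepAllowed a l free then (if l = free then X else 1) * tailSum a w else 0 := by
  cases a <;> cases l <;> simp [blockSum, tailSum, StepAllowed]

/-- Apart from the first block, a block contributes the factor `X` if it lies between equal letters,
since it has to be free, and `X + 1` if it lies between different letters or at the end. -/
theorem tailSum_mul_pow (a : XYLetter) (w : List XYLetter) :
    tailSum a w * X ^ (1 + letterChanges (a :: w)) =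
      (X + 1) ^ (1 + letterChanges (a :: w)) * X ^ (w.length + 1) := by
  induction w generalizing a with
  | nil =>
    cases a <;> simp [tailSum, sum_coordLabel, StepAllowed, blockSum, letterChanges] <;> ring
  | cons b w ih =>
    have hstep : tailSum a (b :: w) = (if a = b then X else X + 1) * tailSum b w := by
      cases a <;> cases b <;>
        simp [tailSum, sum_coordLabel, StepAllowed, blockSum_cons] <;> ring
    rw [hstep, letterChanges, List.length_cons]
    by_cases h : a = b
    · rw [if_pos h, if_neg (not_not.2 h)]
      linear_combination X * ih b
    · rw [if_neg h, if_pos h]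
      linear_combination (X + 1) * X * ih b

theorem sum_blockSum_cons (a : XYLetter) (w : List XYLetter) :
    (∑ l, blockSum (a :: w) l) * X ^ kappa (a :: w) =
      (X + 1) ^ kappa (a :: w) * X ^ ((a :: w).length + 1) := by
  have hsum : ∑ l, blockSum (a :: w) l = (X + 1) * tailSum a w := by
    cases a <;> (simp [sum_coordLabel, StepAllowed, blockSum_cons]; ring)
  rw [hsum, kappa, if_neg (List.cons_ne_nil a w), List.length_cons]
  linear_combination (X + 1) * X * tailSum_mul_pow a w

theorem algebraMap_sum_blockSum (w : List XYLetter) :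
    algebraMap ℤ[X] (RatFunc ℤ) (∑ l, blockSum w l) = (if w = [] then 1 else 0) +
      ((RatFunc.X + 1) / RatFunc.X) ^ kappa w * RatFunc.X ^ (w.length + 1) := by
  have hX : (RatFunc.X : RatFunc ℤ) ≠ 0 := by
    rw [← RatFunc.algebraMap_X]
    exact RatFunc.algebraMap_ne_zero X_ne_zero
  cases w with
  | nil =>
    rw [sum_blockSum_nil, kappa, if_pos rfl, if_pos rfl, List.length_nil, zero_add, pow_one,
      pow_one, div_mul_cancel₀ _ hX, map_add, RatFunc.algebraMap_X, map_ofNat,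
      ← one_add_one_eq_two]
    abel
  | cons a w =>
    have key := congrArg (algebraMap ℤ[X] (RatFunc ℤ)) (sum_blockSum_cons a w)
    simp only [map_mul, map_pow, map_add, map_one, RatFunc.algebraMap_X] at key
    rw [if_neg (List.cons_ne_nil a w), zero_add, div_pow, div_mul_eq_mul_div, ← key,
      mul_div_cancel_right₀ _ (pow_ne_zero _ hX)]

theorem length_subword (v : List XYLetter) (T : Finset (Fin v.length)) :
    (subword v T).length = T.card := by
  have hnodup : ((List.finRange v.length).filter (fun i => i ∈ T)).Nodup :=
    (List.nodup_finRange _).filter _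
  rw [subword, List.length_map, ← List.toFinset_card_of_nodup hnodup]
  congr 1
  ext i
  simp

theorem subword_eq_nil {v : List XYLetter} {T : Finset (Fin v.length)} :
    subword v T = [] ↔ T = ∅ := by
  rw [← List.length_eq_zero_iff, length_subword, Finset.card_eq_zero]

/-- For every word `v` (of length `n - 1`, `n = v.length + 1`), the polytope `DP_v` has finitely
many faces and its `f`-polynomial is given by the formula, an identity in the field `ℚ(t)` of
fractions of `ℤ[t]`. -/
theorem theorem2p2 (v : List XYLetter) :
    (polytopeFaces (wordDescentPolytope v)).Finite ∧
      algebraMap ℤ[X] (RatFunc ℤ) (fPolynomial (wordDescentPolytope v)) =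
        1 + ∑ T : Finset (Fin v.length),
          ((RatFunc.X + 1) / RatFunc.X) ^ kappa (subword v T) * RatFunc.X ^ (T.card + 1) := by
  have hP : wordDescentPolytope v = letterPolytope v.get := rfl
  rw [hP]
  refine ⟨(bijOn_patternFace v.get).image_eq ▸ Set.toFinite _, ?_⟩
  have hsum (T : Finset (Fin v.length)) :
      (∑ c, if IsPattern v.get T c then (X : ℤ[X]) ^ freeBlocks T c else 0) =
        ∑ l, blockSum (subword v T) l := by
    simp only [← sum_pattern_eq_blockSum]
    rw [Finset.sum_comm]
    refine Finset.sum_congr rfl fun c _ => ?_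
    simp [ite_and]
  simp only [fPolynomial_letterPolytope, hsum]
  rw [map_sum]
  simp only [algebraMap_sum_blockSum, length_subword, subword_eq_nil, Finset.sum_add_distrib]
  simp
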